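/- **Setting.** Let $n\ge 2$, let $x_1,\dots,x_n\in\mathbb{R}^d$ be a fixed design, let $w,R\in\mathbb{R}$, $\gamma>0$, $\delta\in(0,1)$, and let $$\Theta=\{\theta\in\mathbb{R}^d:\ \|\theta\|_2\le w,\ \min(\|\theta\|_2^2,\langle\theta,x_i\rangle)\ge\gamma\ \text{ for all } i\}.$$ Let $\theta^*\in\Theta$, put $\mu_i=\langle\theta^*,x_i\rangle$, and let $y_1,\dots,y_n$ be independent with $y_i\sim\mathrm{Poisson}(\mu_i)$. Put $u_i=x_i/\|x_i\|_2$, $$\Sigma=\frac1n\sum_{i=1}^n x_ix_i^T,\qquad M=\frac1n\sum_{i=1}^n\mu_iu_iu_i^T,\qquad \chi=\frac{\lambda_{\max}(M)}{\lambda_{\min}(M)}.$$ A maximum likelihood estimate (MLE) for $y$ is any minimizer over $\theta\in\Theta$ of $\sum_{i=1}^n-\log\left(\langle\theta,x_i\rangle^{y_i}e^{-\langle\theta,x_i\rangle}/y_i!\right)$. The excess square risk of $\theta$ is $$\mathcal{E}(\theta)=\mathbb{E}\Big[\frac1n\sum_{i=1}^n(y_i-\langle\theta,x_i\rangle)^2\Big]-\mathbb{E}\Big[\frac1n\sum_{i=1}^n(y_i-\langle\theta^*,x_i\rangle)^2\Big],$$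 where $\theta$ is held fixed in the expectations. **Assumptions.** 1. $\lambda_{\min}(\Sigma)>0$ and $\|x_i\|_2\le R$ for all $i$. 2. $\lambda_{\min}(M)\ge\frac{R^2}{4n\gamma^2}\left(d\log(24\chi)+\log\frac1\delta\right)$ and $\sqrt{\lambda_{\max}(M)\left(d\log(24\chi)+\log\frac1\delta\right)}\le\sqrt n\,\lambda_{\min}(M)/16$. 3. The design is $(L,4)$-hypercontractive: for every unit vector $u\in\mathbb{R}^d$, $$\frac1n\sum_{i=1}^n\langle\Sigma^{-1/2}x_i,u\rangle^4\le L\Big(\frac1n\sum_{i=1}^n\langle\Sigma^{-1/2}x_i,u\rangle^2\Big)^2.$$ **Conclusion.** There is a constant $C>0$ depending only on $L$ and $\gamma$ (and not on $n$, $d$, the design, $\theta^*$, $w$, $R$, $\delta$) such that, whenever the above holds, an MLE exists for every $y\in\mathbb{N}^n$, and with probability at least $1-\delta$ every MLE $\hat\theta$ satisfies $$\mathcal{E}(\hat\theta)\le C\,\|\theta^*\|_2^2\,\lambda_{\max}(\Sigma)\,\frac{d\left(\log n+\max\{0,\log(wR\lambda_{\max}(\Sigma))\}+\log\chi+\log\frac1\delta\right)}{n}.$$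 -/

import Mathlib

open MeasureTheory ProbabilityTheory
open scoped Real Matrix

namespace PoissonMLE

noncomputable section

/-- The normalized covariance matrix `Σ = (1/n) ∑ᵢ xᵢ xᵢᵀ` of the fixed design `x₁, …, xₙ ∈ ℝᵈ`. -/
def designCov {n d : ℕ} (x : Fin n → EuclideanSpace ℝ (Fin d)) : Matrix (Fin d) (Fin d) ℝ :=
  (n : ℝ)⁻¹ • ∑ i, Matrix.of fun j k => x i j * x i k

/-- The matrix `M = (1/n) ∑ᵢ μᵢ uᵢ uᵢᵀ`, where `μᵢ = ⟨θ*, xᵢ⟩` and `uᵢ = xᵢ / ‖xᵢ‖`. -/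
def meanCov {n d : ℕ} (x : Fin n → EuclideanSpace ℝ (Fin d)) (θs : EuclideanSpace ℝ (Fin d)) :
    Matrix (Fin d) (Fin d) ℝ :=
  (n : ℝ)⁻¹ • ∑ i, inner ℝ θs (x i) • Matrix.of fun j k => (x i j / ‖x i‖) * (x i k / ‖x i‖)

/-- The largest eigenvalue of a real symmetric matrix. -/
def lamMax {d : ℕ} (A : Matrix (Fin d) (Fin d) ℝ) : ℝ := sSup (spectrum ℝ A)

/-- The smallest eigenvalue of a real symmetric matrix. -/
def lamMin {d : ℕ} (A : Matrix (Fin d) (Fin d) ℝ) : ℝ := sInf (spectrum ℝ A)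

/-- The condition number of a real symmetric positive definite matrix. -/
def condNumber {d : ℕ} (A : Matrix (Fin d) (Fin d) ℝ) : ℝ := lamMax A / lamMin A

/-- The inverse square root `A ^ (-1/2)` of a real symmetric positive definite matrix,
through the functional calculus. -/
def invSqrt {d : ℕ} (A : Matrix (Fin d) (Fin d) ℝ) : Matrix (Fin d) (Fin d) ℝ :=
  cfc (fun t : ℝ => (√t)⁻¹) A

/-- The design is `(L, 4)`-hypercontractive: with `E` the empirical average over the design,
`E[(Σ^(-1/2) x · u)⁴] ≤ L (E[(Σ^(-1/2) x · u)²])²` for every unit vector `u`. -/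
def IsHypercontractive {n d : ℕ} (L : ℝ) (x : Fin n → EuclideanSpace ℝ (Fin d)) : Prop :=
  ∀ u : EuclideanSpace ℝ (Fin d), ‖u‖ = 1 →
    (n : ℝ)⁻¹ * ∑ i, ((invSqrt (designCov x) *ᵥ (x i).ofLp) ⬝ᵥ u.ofLp) ^ 4 ≤
      L * ((n : ℝ)⁻¹ * ∑ i, ((invSqrt (designCov x) *ᵥ (x i).ofLp) ⬝ᵥ u.ofLp) ^ 2) ^ 2

/-- The parameter space: `‖θ‖ ≤ w` and `min (‖θ‖², ⟨θ, xᵢ⟩) ≥ γ` for all `i`. -/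
def paramSpace {n d : ℕ} (x : Fin n → EuclideanSpace ℝ (Fin d)) (w γ : ℝ) :
    Set (EuclideanSpace ℝ (Fin d)) :=
  {θ | ‖θ‖ ≤ w ∧ ∀ i, γ ≤ min (‖θ‖ ^ 2) (inner ℝ θ (x i))}

/-- The joint law of the responses `y₁, …, yₙ`: independent, with `yᵢ ∼ Poisson ⟨θ, xᵢ⟩`. -/
def responseLaw {n d : ℕ} (x : Fin n → EuclideanSpace ℝ (Fin d)) (θ : EuclideanSpace ℝ (Fin d)) :
    Measure (Fin n → ℕ) :=
  Measure.pi fun i => poissonMeasure (inner ℝ θ (x i)).toNNReal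

/-- The negative log-likelihood `∑ᵢ -log p(yᵢ | xᵢ; θ)`, where `p(k | x; θ) = μᵏ e^(-μ) / k!`
with `μ = ⟨θ, x⟩`. -/
def negLogLik {n d : ℕ} (x : Fin n → EuclideanSpace ℝ (Fin d)) (y : Fin n → ℕ)
    (θ : EuclideanSpace ℝ (Fin d)) : ℝ :=
  ∑ i, -Real.log
    ((inner ℝ θ (x i)) ^ (y i) * Real.exp (-(inner ℝ θ (x i))) / (Nat.factorial (y i) : ℝ))

/-- `θ` is a maximum likelihood estimate in the parameter space for the observation `y`. -/
def IsMLE {n d : ℕ} (x : Fin n → EuclideanSpace ℝ (Fin d)) (w γ : ℝ) (y : Fin n → ℕ)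
    (θ : EuclideanSpace ℝ (Fin d)) : Prop :=
  θ ∈ paramSpace x w γ ∧ IsMinOn (negLogLik x y) (paramSpace x w γ) θ

/-- The expected square loss `E[(1/n) ∑ᵢ (yᵢ - ⟨θ, xᵢ⟩)²]`, with `y` drawn under `θs`. -/
def squareRisk {n d : ℕ} (x : Fin n → EuclideanSpace ℝ (Fin d)) (θs θ : EuclideanSpace ℝ (Fin d)) :
    ℝ :=
  ∫ y, (n : ℝ)⁻¹ * ∑ i, ((y i : ℝ) - inner ℝ θ (x i)) ^ 2 ∂(responseLaw x θs)

/-- The excess square loss risk of the linear predictor with parameter `θ`. -/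
def excessRisk {n d : ℕ} (x : Fin n → EuclideanSpace ℝ (Fin d)) (θs θ : EuclideanSpace ℝ (Fin d)) :
    ℝ :=
  squareRisk x θs θ - squareRisk x θs θs

end

end PoissonMLE

/-!
Write `b i = ⟨θ*, xᵢ⟩`, `a i = ⟨θ, xᵢ⟩`, and let `m` be the mean of `b`. The excess risk of `θ` is the
mean of `(a i - b i)²` (`excessRisk_eq`), and a maximum likelihood estimate has a likelihood at
least that of `θ*`. The argument converts this into a bound on the squared Hellinger distance
`H = ∑ (√(a i) - √(b i))²`, and that into a bound on the risk.

*Total intensity.* Optimizing over all positive vectors `a`, with no model, a likelihood at least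
that of `b` forces `∑ a ≤ 2 ∑ b + 2 ∑ y log (y / b)` (`sum_le_of_logLikRatio_nonneg`). The last sum
has an exponential moment of order `1/2` (`poisson_exp_half_mul_log`), and the conditions on `M`
make `log (1 / δ)` at most `∑ b` (`one_le_condNumber_and_log_inv_le`), so `∑ a` is of order `∑ b`
with high probability.

*Hellinger distance.* The square root of the likelihood ratio of a fixed `a` has mean
`exp (-H / 2)` (`poisson_affinity`), so Chernoff's bound and a union bound over a net control all
candidates. The vectors `a` of bounded total lie in a subspace of dimension at most `d`, and a
grid of accuracy `m / n` has polynomially many points in `n`, to the power `d`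
(`exists_intensity_net`). Rounding the intensities *up* to the grid costs only a deterministic
amount of likelihood (`hellinger_le_of_near`). Hence `H ≲ m + d log n + log (1 / δ)`
(`responseLaw_hellinger`).

*Risk.* Hypercontractivity bounds the second moment of `a - b` by its squared first moment
(`mean_sq_le_of_mean_pow_four_le`), and Cauchy-Schwarz bounds the latter by `m H / n`
(`excessRisk_le_of_hellinger`). Finally `m ≥ γ` and `m² ≤ ‖θ*‖² λ_max(Σ)`.
-/

namespace PoissonMLE

/-! ### Exponential moments of Poisson variables -/

lemma integrable_exp_poisson_of_hasSum {b t : ℝ} (hb : 0 < b) {f : ℕ → ℝ}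
    (h : HasSum (fun k : ℕ => Real.exp (-b) * b ^ k / (k.factorial : ℝ) * Real.exp (f k)) t) :
    Integrable (fun k => Real.exp (f k)) (poissonMeasure b.toNNReal) ∧
      ∫ k, Real.exp (f k) ∂(poissonMeasure b.toNNReal) = t := by
  have hI : Integrable (fun k => Real.exp (f k)) (poissonMeasure b.toNNReal) := by
    rw [integrable_poissonMeasure_iff]
    simpa [Real.coe_toNNReal b hb.le] using h.summable
  refine ⟨hI, (hasSum_integral_poissonMeasure hI).unique ?_⟩
  simpa [Real.coe_toNNReal b hb.le] using h

/-- The Bhattacharyya affinity between two Poisson laws: under `Poisson b`, the square root of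
the likelihood ratio of `Poisson a` has mean `exp (-(√a - √b)² / 2)`. -/
lemma poisson_affinity {a b : ℝ} (ha : 0 < a) (hb : 0 < b) :
    Integrable (fun k : ℕ => Real.exp ((k * Real.log (a / b) - (a - b)) / 2))
        (poissonMeasure b.toNNReal) ∧
      ∫ k : ℕ, Real.exp ((k * Real.log (a / b) - (a - b)) / 2) ∂(poissonMeasure b.toNNReal) =
        Real.exp (-(√a - √b) ^ 2 / 2) := by
  apply integrable_exp_poisson_of_hasSum hb
  have h := (NormedSpace.expSeries_div_hasSum_exp (√a * √b)).mul_left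
    (Real.exp (-b) * Real.exp (-(a - b) / 2))
  rw [← Real.exp_eq_exp_ℝ] at h
  have hva : √a ^ 2 = a := Real.sq_sqrt ha.le
  have hvb : √b ^ 2 = b := Real.sq_sqrt hb.le
  have hsb : 0 < √b := Real.sqrt_pos.2 hb
  have hval : Real.exp (-(√a - √b) ^ 2 / 2) =
      Real.exp (-b) * Real.exp (-(a - b) / 2) * Real.exp (√a * √b) := by
    rw [← Real.exp_add, ← Real.exp_add]
    congr 1
    nlinarith
  rw [hval]
  have hterm : ∀ k : ℕ, Real.exp (-b) * b ^ k / (k.factorial : ℝ) *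
      Real.exp ((k * Real.log (a / b) - (a - b)) / 2) =
      Real.exp (-b) * Real.exp (-(a - b) / 2) * ((√a * √b) ^ k / (k.factorial : ℝ)) := by
    intro k
    have h1 : Real.exp ((k * Real.log (a / b) - (a - b)) / 2) =
        (√a / √b) ^ k * Real.exp (-(a - b) / 2) := by
      rw [← Real.sqrt_div ha.le, ← Real.exp_log (Real.sqrt_pos.2 (div_pos ha hb)),
        ← Real.exp_nat_mul, ← Real.exp_add, Real.log_sqrt (div_pos ha hb).le]
      congr 1; ring
    have h2 : b ^ k * (√a / √b) ^ k = (√a * √b) ^ k := by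
      rw [← mul_pow]; congr 1; field_simp; rw [hvb]
    rw [h1, ← h2]; ring
  simp_rw [hterm]
  exact h

/-- The self-normalized deviation `y log (y / b)` of `y ∼ Poisson b` has an exponential moment of
order `1/2`. The order `1` moment is infinite, since `k ^ k / k!` grows like `e ^ k`. -/
lemma poisson_exp_half_mul_log {b : ℝ} (hb : 0 < b) :
    Integrable (fun k : ℕ => Real.exp (k * Real.log (k / b) / 2)) (poissonMeasure b.toNNReal) ∧
      ∫ k : ℕ, Real.exp (k * Real.log (k / b) / 2) ∂(poissonMeasure b.toNNReal) ≤
        Real.exp (6 * b + 1) := by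
  set c : ℝ := 2 * b * Real.exp 1 with hc
  have hmaj := ((NormedSpace.expSeries_div_hasSum_exp c).add hasSum_geometric_two).mul_left
    (Real.exp (-b) / 2)
  rw [← Real.exp_eq_exp_ℝ] at hmaj
  have hle : ∀ k : ℕ, Real.exp (-b) * b ^ k / (k.factorial : ℝ) *
      Real.exp (k * Real.log (k / b) / 2) ≤
      Real.exp (-b) / 2 * (c ^ k / (k.factorial : ℝ) + (1 / 2) ^ k) := by
    intro k
    have hf : (0 : ℝ) < k.factorial := by positivity
    set q := Real.exp (k * Real.log (k / b) / 2) with hq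
    have hq2 : q ^ 2 = (k / b) ^ k := by
      rw [hq, ← Real.exp_nat_mul]
      rcases Nat.eq_zero_or_pos k with rfl | hk
      · simp
      · have : (0 : ℝ) < k / b := by positivity
        conv_rhs => rw [← Real.exp_log this, ← Real.exp_nat_mul]
        congr 1; push_cast; ring
    have hke : (k : ℝ) ^ k / (k.factorial : ℝ) ≤ Real.exp 1 ^ k := by
      rw [← Real.exp_nat_mul, mul_one]
      exact Real.pow_div_factorial_le_exp k (by positivity) k
    -- the arithmetic-geometric mean inequality for the two majorizing terms
    have key : b ^ k / (k.factorial : ℝ) * q ≤ (c ^ k / (k.factorial : ℝ) + (1 / 2) ^ k) / 2 := by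
      apply le_of_sq_le_sq _ (by positivity)
      have h1 : (b ^ k / (k.factorial : ℝ) * q) ^ 2 =
          b ^ k / (k.factorial : ℝ) * ((k : ℝ) ^ k / (k.factorial : ℝ)) := by
        rw [mul_pow, hq2, div_pow, div_pow]; field_simp
      have h2 : b ^ k / (k.factorial : ℝ) * Real.exp 1 ^ k =
          c ^ k / (k.factorial : ℝ) * (1 / 2) ^ k := by
        rw [div_mul_eq_mul_div, div_mul_eq_mul_div, ← mul_pow, ← mul_pow, hc]
        congr 2; ring
      have h3 : b ^ k / (k.factorial : ℝ) * ((k : ℝ) ^ k / (k.factorial : ℝ)) ≤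
          b ^ k / (k.factorial : ℝ) * Real.exp 1 ^ k :=
        mul_le_mul_of_nonneg_left hke (by positivity)
      rw [h1]
      nlinarith [sq_nonneg (c ^ k / (k.factorial : ℝ) - (1 / 2) ^ k)]
    calc _ = Real.exp (-b) * (b ^ k / (k.factorial : ℝ) * q) := by ring
      _ ≤ Real.exp (-b) * ((c ^ k / (k.factorial : ℝ) + (1 / 2) ^ k) / 2) := by gcongr
      _ = _ := by ring
  have hs := Summable.of_nonneg_of_le (fun k => by positivity) hle hmaj.summable
  obtain ⟨hI, hint⟩ := integrable_exp_poisson_of_hasSum hb hs.hasSum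
  refine ⟨hI, hint.trans_le (tsum_le_of_sum_le' ?_ ?_)⟩
  · positivity
  · intro s
    have hcb : c ≤ 6 * b := by
      have := Real.exp_one_lt_d9
      rw [hc]; nlinarith
    have h1 : Real.exp c ≤ Real.exp (6 * b) := Real.exp_le_exp.2 hcb
    have h2 : 1 ≤ Real.exp (6 * b) := Real.one_le_exp (by positivity)
    have h3 : Real.exp (-b) ≤ 1 := Real.exp_le_one_iff.2 (by linarith)
    have h4 : (2 : ℝ) ≤ Real.exp 1 := by linarith [Real.exp_one_gt_d9]
    calc _ ≤ ∑ k ∈ s, Real.exp (-b) / 2 * (c ^ k / (k.factorial : ℝ) + (1 / 2) ^ k) :=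
          Finset.sum_le_sum fun k _ => hle k
      _ ≤ _ := sum_le_hasSum s (fun k _ => by positivity) hmaj
      _ ≤ 1 / 2 * (Real.exp (6 * b) + 2) := by gcongr
      _ ≤ Real.exp (6 * b) * Real.exp 1 := by nlinarith
      _ = _ := by rw [← Real.exp_add]

/-- Chernoff's bound for a sum of functions of independent variables. -/
lemma pi_chernoff {n : ℕ} (ν : Fin n → Measure ℕ) [∀ i, IsProbabilityMeasure (ν i)]
    (f : Fin n → ℕ → ℝ) (K : Fin n → ℝ) (hI : ∀ i, Integrable (fun k => Real.exp (f i k)) (ν i))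
    (hK : ∀ i, ∫ k, Real.exp (f i k) ∂(ν i) ≤ Real.exp (K i)) {p : ℝ} (hp : 0 < p) :
    Measure.pi ν {y | ∑ i, K i + Real.log (1 / p) < ∑ i, f i (y i)} ≤ ENNReal.ofReal p := by
  set c := ∑ i, K i + Real.log (1 / p)
  have hprod : (fun y : Fin n → ℕ => Real.exp (1 * ∑ i, f i (y i))) =
      fun y => ∏ i, Real.exp (f i (y i)) := by
    funext y; rw [one_mul, Real.exp_sum]
  have hint : Integrable (fun y : Fin n → ℕ => Real.exp (1 * ∑ i, f i (y i))) (Measure.pi ν) := by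
    rw [hprod]; exact Integrable.fintype_prod_dep hI
  have h := measure_ge_le_exp_mul_mgf (μ := Measure.pi ν) (X := fun y => ∑ i, f i (y i)) c
    zero_le_one hint
  have hm : mgf (fun y => ∑ i, f i (y i)) (Measure.pi ν) 1 ≤ Real.exp (∑ i, K i) := by
    rw [mgf, hprod, integral_fintype_prod_eq_prod (fun i k => Real.exp (f i k)), Real.exp_sum]
    exact Finset.prod_le_prod (fun i _ => integral_nonneg fun _ => (Real.exp_pos _).le)
      fun i _ => hK i
  rw [← ofReal_measureReal]
  apply ENNReal.ofReal_le_ofReal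
  calc _ ≤ (Measure.pi ν).real {y | c ≤ ∑ i, f i (y i)} :=
        measureReal_mono (Set.ofPred_subset_ofPred.2 fun y hy => hy.le)
    _ ≤ _ := h
    _ ≤ Real.exp (-1 * c) * Real.exp (∑ i, K i) := by gcongr
    _ = p := by
      rw [← Real.exp_add, show -1 * c + ∑ i, K i = Real.log p by
        simp only [c, one_div, Real.log_inv]; ring, Real.exp_log hp]

/-! ### Grids in Euclidean spaces -/

/-- A ball of radius `s K` in a `k`-dimensional Euclidean space is covered to accuracy `k s` by
the `(2 K + 1) ^ k` points of a grid of step `s` in an orthonormal basis. -/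
lemma exists_grid (V : Type*) [NormedAddCommGroup V] [InnerProductSpace ℝ V]
    [FiniteDimensional ℝ V] {s : ℝ} (hs : 0 < s) (K : ℕ) :
    ∃ N : Finset V, N.card ≤ (2 * K + 1) ^ Module.finrank ℝ V ∧
      ∀ v : V, ‖v‖ ≤ s * K → ∃ u ∈ N, ‖v - u‖ ≤ Module.finrank ℝ V * s := by
  classical
  let e := stdOrthonormalBasis ℝ V
  refine ⟨(Fintype.piFinset fun _ : Fin (Module.finrank ℝ V) =>
    Finset.Icc (-(K : ℤ)) K).image (fun z => ∑ j, (s * z j) • e j), ?_, ?_⟩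
  · refine Finset.card_image_le.trans ?_
    rw [Fintype.card_piFinset]
    simp only [Int.card_Icc, Finset.prod_const, Finset.card_univ, Fintype.card_fin]
    apply le_of_eq; congr 1; omega
  · intro v hv
    refine ⟨∑ j, (s * (⌊inner ℝ (e j) v / s⌋ : ℤ)) • e j, Finset.mem_image.2
      ⟨fun j => ⌊inner ℝ (e j) v / s⌋, ?_, rfl⟩, ?_⟩
    · rw [Fintype.mem_piFinset]
      intro j
      have h1 : |inner ℝ (e j) v| ≤ s * K := by
        refine (abs_real_inner_le_norm _ _).trans ?_
        rwa [e.norm_eq_one, one_mul]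
      have h2 := abs_le.1 h1
      rw [Finset.mem_Icc]
      constructor
      · rw [Int.le_floor, le_div_iff₀ hs]; push_cast; linarith
      · have : (⌊inner ℝ (e j) v / s⌋ : ℝ) ≤ K :=
          (Int.floor_le _).trans (by rw [div_le_iff₀ hs]; linarith)
        exact_mod_cast this
    · rw [show v - ∑ j, (s * (⌊inner ℝ (e j) v / s⌋ : ℤ)) • e j = ∑ j, (inner ℝ (e j) v • e j -
        (s * (⌊inner ℝ (e j) v / s⌋ : ℤ)) • e j) by rw [Finset.sum_sub_distrib, e.sum_repr' v]]
      refine (norm_sum_le _ _).trans ?_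
      calc _ ≤ ∑ _j : Fin (Module.finrank ℝ V), s := by
            refine Finset.sum_le_sum fun j _ => ?_
            rw [← sub_smul, norm_smul, e.norm_eq_one, mul_one, Real.norm_eq_abs, abs_le]
            have h1 := Int.floor_le (inner ℝ (e j) v / s)
            have h2 := Int.lt_floor_add_one (inner ℝ (e j) v / s)
            rw [le_div_iff₀ hs] at h1
            rw [div_lt_iff₀ hs] at h2
            constructor <;> nlinarith
        _ = _ := by simp

/-! ### Spectral bounds for the design matrices -/

lemma isHermitian_weightedGram {n d : ℕ} (c : ℝ) (w : Fin n → ℝ) (p : Fin n → Fin d → ℝ) :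
    (c • ∑ i, w i • Matrix.of fun j k => p i j * p i k).IsHermitian := by
  ext j k
  simp [Matrix.sum_apply, mul_comm]

lemma weightedGram_quadForm {n d : ℕ} (c : ℝ) (w : Fin n → ℝ) (p : Fin n → Fin d → ℝ)
    (v : Fin d → ℝ) :
    v ⬝ᵥ ((c • ∑ i, w i • Matrix.of fun j k => p i j * p i k) *ᵥ v) =
      c * ∑ i, w i * (v ⬝ᵥ p i) ^ 2 := by
  have h : ∀ i, (Matrix.of fun j k => p i j * p i k) *ᵥ v = (v ⬝ᵥ p i) • p i := by
    intro i
    ext j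
    simp only [Matrix.mulVec, dotProduct, Matrix.of_apply, Pi.smul_apply, smul_eq_mul,
      Finset.sum_mul]
    exact Finset.sum_congr rfl fun k _ => by ring
  rw [Matrix.smul_mulVec, Matrix.sum_mulVec, dotProduct_smul, dotProduct_sum, smul_eq_mul]
  congr 1
  refine Finset.sum_congr rfl fun i _ => ?_
  rw [Matrix.smul_mulVec, h, dotProduct_smul, dotProduct_smul, smul_eq_mul, smul_eq_mul, sq]

lemma quadForm_le_lamMax {d : ℕ} {A : Matrix (Fin d) (Fin d) ℝ} (hA : A.IsHermitian)
    (v : Fin d → ℝ) : v ⬝ᵥ (A *ᵥ v) ≤ lamMax A * (v ⬝ᵥ v) := by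
  have hps : (algebraMap ℝ (Matrix (Fin d) (Fin d) ℝ) (lamMax A) - A).PosSemidef := by
    rw [Matrix.posSemidef_iff_isHermitian_and_spectrum_nonneg]
    refine ⟨?_, ?_⟩
    · refine Matrix.IsHermitian.sub ?_ hA
      rw [Matrix.algebraMap_eq_diagonal]
      exact Matrix.isHermitian_diagonal _
    · rw [← spectrum.singleton_sub_eq]
      rintro _ ⟨_, rfl, t, ht, rfl⟩
      exact sub_nonneg.2 (le_csSup A.finite_real_spectrum.bddAbove ht)
  have h := hps.dotProduct_mulVec_nonneg v
  rw [Matrix.sub_mulVec, dotProduct_sub, Algebra.algebraMap_eq_smul_one, Matrix.smul_mulVec,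
    Matrix.one_mulVec, dotProduct_smul, star_trivial, smul_eq_mul] at h
  linarith

lemma lamMin_le_quadForm {d : ℕ} {A : Matrix (Fin d) (Fin d) ℝ} (hA : A.IsHermitian)
    (v : Fin d → ℝ) : lamMin A * (v ⬝ᵥ v) ≤ v ⬝ᵥ (A *ᵥ v) := by
  have hps : (A - algebraMap ℝ (Matrix (Fin d) (Fin d) ℝ) (lamMin A)).PosSemidef := by
    rw [Matrix.posSemidef_iff_isHermitian_and_spectrum_nonneg]
    refine ⟨?_, ?_⟩
    · refine Matrix.IsHermitian.sub hA ?_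
      rw [Matrix.algebraMap_eq_diagonal]
      exact Matrix.isHermitian_diagonal _
    · rw [← spectrum.sub_singleton_eq]
      rintro _ ⟨t, ht, _, rfl, rfl⟩
      exact sub_nonneg.2 (csInf_le A.finite_real_spectrum.bddBelow ht)
  have h := hps.dotProduct_mulVec_nonneg v
  rw [Matrix.sub_mulVec, dotProduct_sub, Algebra.algebraMap_eq_smul_one, Matrix.smul_mulVec,
    Matrix.one_mulVec, dotProduct_smul, star_trivial, smul_eq_mul] at h
  linarith

lemma dotProduct_ofLp {d : ℕ} (v z : EuclideanSpace ℝ (Fin d)) :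
    v.ofLp ⬝ᵥ z.ofLp = inner ℝ v z := by
  rw [EuclideanSpace.inner_eq_star_dotProduct, star_trivial, dotProduct_comm]

lemma designCov_eq_weightedGram {n d : ℕ} (x : Fin n → EuclideanSpace ℝ (Fin d)) :
    designCov x = (n : ℝ)⁻¹ • ∑ i, (1 : ℝ) • Matrix.of fun j k => (x i).ofLp j * (x i).ofLp k := by
  simp only [one_smul]; rfl

lemma isHermitian_designCov {n d : ℕ} (x : Fin n → EuclideanSpace ℝ (Fin d)) :
    (designCov x).IsHermitian := by
  rw [designCov_eq_weightedGram]; exact isHermitian_weightedGram _ _ _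

lemma mean_inner_sq_le {n d : ℕ} (x : Fin n → EuclideanSpace ℝ (Fin d))
    (v : EuclideanSpace ℝ (Fin d)) :
    (n : ℝ)⁻¹ * ∑ i, inner ℝ v (x i) ^ 2 ≤ ‖v‖ ^ 2 * lamMax (designCov x) := by
  have h := quadForm_le_lamMax (isHermitian_designCov x) v.ofLp
  rw [designCov_eq_weightedGram, weightedGram_quadForm, ← designCov_eq_weightedGram] at h
  simp only [dotProduct_ofLp, one_mul, real_inner_self_eq_norm_sq] at h
  linarith

lemma lamMin_eq_zero_of_dim_zero (A : Matrix (Fin 0) (Fin 0) ℝ) : lamMin A = 0 := by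
  rw [lamMin, spectrum.of_subsingleton, Real.sInf_empty]

lemma lamMin_le_lamMax {d : ℕ} {A : Matrix (Fin d) (Fin d) ℝ} (h : 0 < lamMin A) : lamMin A ≤ lamMax A := by
  have hne : (spectrum ℝ A).Nonempty := by
    by_contra hne
    rw [Set.not_nonempty_iff_eq_empty] at hne
    rw [lamMin, hne, Real.sInf_empty] at h
    exact h.false
  obtain ⟨t, ht⟩ := hne
  exact (csInf_le A.finite_real_spectrum.bddBelow ht).trans
    (le_csSup A.finite_real_spectrum.bddAbove ht)

lemma isHermitian_meanCov {n d : ℕ} (x : Fin n → EuclideanSpace ℝ (Fin d))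
    (θs : EuclideanSpace ℝ (Fin d)) : (meanCov x θs).IsHermitian :=
  isHermitian_weightedGram _ (fun i => inner ℝ θs (x i)) fun i j => x i j / ‖x i‖

lemma meanCov_quadForm {n d : ℕ} (x : Fin n → EuclideanSpace ℝ (Fin d))
    (θs : EuclideanSpace ℝ (Fin d)) (v : Fin d → ℝ) :
    v ⬝ᵥ (meanCov x θs *ᵥ v) =
      (n : ℝ)⁻¹ * ∑ i, inner ℝ θs (x i) * (v ⬝ᵥ fun j => x i j / ‖x i‖) ^ 2 :=
  weightedGram_quadForm _ (fun i => inner ℝ θs (x i)) (fun i j => x i j / ‖x i‖) v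

/-- Since the `uᵢ` are unit vectors, a diagonal entry of `M` is at most the average of the `μᵢ`. -/
lemma lamMin_meanCov_le {n d : ℕ} (hd : 0 < d) (x : Fin n → EuclideanSpace ℝ (Fin d))
    (θs : EuclideanSpace ℝ (Fin d)) (hpos : ∀ i, 0 < inner ℝ θs (x i)) :
    lamMin (meanCov x θs) ≤ (n : ℝ)⁻¹ * ∑ i, inner ℝ θs (x i) := by
  have h := lamMin_le_quadForm (isHermitian_meanCov x θs) (Pi.single (⟨0, hd⟩ : Fin d) 1)
  rw [meanCov_quadForm] at h
  simp only [single_dotProduct, one_mul, Pi.single_eq_same, mul_one] at h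
  refine h.trans ?_
  gcongr with i
  refine mul_le_of_le_one_right (hpos i).le ?_
  rw [sq_le_one_iff_abs_le_one, abs_div, abs_norm]
  exact div_le_one_of_le₀ (PiLp.norm_apply_le (x i) _) (norm_nonneg _)

lemma lamMin_meanCov_nonneg {n d : ℕ} (x : Fin n → EuclideanSpace ℝ (Fin d))
    (θs : EuclideanSpace ℝ (Fin d)) (hpos : ∀ i, 0 < inner ℝ θs (x i)) :
    0 ≤ lamMin (meanCov x θs) := by
  refine Real.sInf_nonneg ?_
  have hps : (meanCov x θs).PosSemidef := by
    refine Matrix.PosSemidef.of_dotProduct_mulVec_nonneg (isHermitian_meanCov x θs) fun v => ?_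
    rw [star_trivial, meanCov_quadForm]
    exact mul_nonneg (by positivity)
      (Finset.sum_nonneg fun i _ => mul_nonneg (hpos i).le (sq_nonneg _))
  rw [Matrix.posSemidef_iff_isHermitian_and_spectrum_nonneg] at hps
  exact fun t ht => hps.2 ht

/-- What the two conditions on `M` give: `χ` is at least `1`, and the failure probability is not
exponentially small compared with the total intensity. -/
lemma one_le_condNumber_and_log_inv_le {n d : ℕ} (hn : 0 < n) (hd : 0 < d) {γ R δ : ℝ}
    (hγ : 0 < γ) (hR : 0 < R) (hδ : 0 < δ) (hδ1 : δ < 1) (x : Fin n → EuclideanSpace ℝ (Fin d))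
    (θs : EuclideanSpace ℝ (Fin d)) (hpos : ∀ i, 0 < inner ℝ θs (x i))
    (h1 : R ^ 2 / (4 * n * γ ^ 2) *
            (d * Real.log (24 * condNumber (meanCov x θs)) + Real.log (1 / δ)) ≤
          lamMin (meanCov x θs))
    (h2 : √(lamMax (meanCov x θs) *
            (d * Real.log (24 * condNumber (meanCov x θs)) + Real.log (1 / δ))) ≤
          √(n : ℝ) * lamMin (meanCov x θs) / 16) :
    1 ≤ condNumber (meanCov x θs) ∧ Real.log (1 / δ) ≤ ∑ i, inner ℝ θs (x i) := by
  have hn' : (0 : ℝ) < n := by exact_mod_cast hn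
  have hlδ : 0 < Real.log (1 / δ) := Real.log_pos (by rw [lt_div_iff₀ hδ]; linarith)
  have hmin : 0 < lamMin (meanCov x θs) := by
    refine (lamMin_meanCov_nonneg x θs hpos).lt_of_ne fun h0 => ?_
    rw [condNumber, ← h0, div_zero, mul_zero, Real.log_zero, mul_zero, zero_add] at h1
    have : 0 < R ^ 2 / (4 * n * γ ^ 2) * Real.log (1 / δ) := by positivity
    linarith
  have hle := lamMin_le_lamMax hmin
  have hχ : 1 ≤ condNumber (meanCov x θs) := (one_le_div hmin).2 hle
  refine ⟨hχ, ?_⟩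
  set X := d * Real.log (24 * condNumber (meanCov x θs)) + Real.log (1 / δ) with hX
  have hlX : Real.log (1 / δ) ≤ X := by
    have : 0 ≤ Real.log (24 * condNumber (meanCov x θs)) := Real.log_nonneg (by linarith)
    rw [hX]; nlinarith [mul_nonneg (Nat.cast_nonneg (α := ℝ) d) this]
  have hX0 : 0 < X := hlδ.trans_le hlX
  have hsq := (Real.sqrt_le_left (by positivity)).1 h2
  have hsq' : (√(n : ℝ) * lamMin (meanCov x θs) / 16) ^ 2 =
      n * lamMin (meanCov x θs) ^ 2 / 256 := by
    rw [div_pow, mul_pow, Real.sq_sqrt hn'.le]; norm_num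
  rw [hsq'] at hsq
  have h3 : X ≤ n * lamMin (meanCov x θs) := by
    have h4 : lamMin (meanCov x θs) * X ≤ lamMin (meanCov x θs) * (n * lamMin (meanCov x θs)) := by
      calc _ ≤ lamMax (meanCov x θs) * X := by gcongr
        _ ≤ _ := hsq
        _ ≤ _ := by nlinarith [mul_pos hn' (pow_pos hmin 2)]
    exact le_of_mul_le_mul_left h4 hmin
  have h5 := lamMin_meanCov_le hd x θs hpos
  rw [inv_mul_eq_div, le_div_iff₀ hn'] at h5
  linarith

/-! ### Hypercontractivity -/

/-- The change of variables `u = Σ^(1/2) v / ‖Σ^(1/2) v‖` removes the whitening from the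
hypercontractivity condition. -/
lemma IsHypercontractive.mean_inner_pow_four_le {n d : ℕ} {L : ℝ}
    {x : Fin n → EuclideanSpace ℝ (Fin d)} (h : IsHypercontractive L x)
    (hcov : 0 < lamMin (designCov x)) (v : EuclideanSpace ℝ (Fin d)) :
    (n : ℝ)⁻¹ * ∑ i, inner ℝ v (x i) ^ 4 ≤ L * ((n : ℝ)⁻¹ * ∑ i, inner ℝ v (x i) ^ 2) ^ 2 := by
  set S := invSqrt (designCov x) with hS
  have hsa : IsSelfAdjoint S := cfc_predicate _ _
  have hST : Sᵀ = S := by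
    have : Sᴴ = S := hsa
    rwa [Matrix.conjTranspose_eq_transpose_of_trivial] at this
  have hunit : IsUnit S := by
    refine (isUnit_cfc_iff (fun t : ℝ => (√t)⁻¹) (designCov x)
      ((designCov x).finite_real_spectrum.continuousOn _) (isHermitian_designCov x)).2 ?_
    intro t ht
    have : lamMin (designCov x) ≤ t :=
      csInf_le (designCov x).finite_real_spectrum.bddBelow ht
    exact inv_ne_zero (Real.sqrt_ne_zero'.2 (hcov.trans_le this))
  have hSB : S * S⁻¹ = 1 := Matrix.mul_nonsing_inv _ ((Matrix.isUnit_iff_isUnit_det _).1 hunit)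
  set z : EuclideanSpace ℝ (Fin d) := WithLp.toLp 2 (S⁻¹ *ᵥ v.ofLp) with hz
  have hzx : ∀ i, (S *ᵥ (x i).ofLp) ⬝ᵥ z.ofLp = inner ℝ v (x i) := by
    intro i
    rw [dotProduct_comm, Matrix.dotProduct_mulVec, ← Matrix.mulVec_transpose, hST, hz,
      Matrix.mulVec_mulVec, hSB, Matrix.one_mulVec, dotProduct_ofLp]
  rcases eq_or_ne z 0 with h0 | h0
  · have : ∀ i, inner ℝ v (x i) = 0 := fun i => by rw [← hzx i, h0]; simp
    simp [this]
  · have hnz : 0 < ‖z‖ := norm_pos_iff.2 h0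
    have hu := h (‖z‖⁻¹ • z) (by rw [norm_smul, norm_inv, norm_norm, inv_mul_cancel₀ hnz.ne'])
    have e : ∀ i, (S *ᵥ (x i).ofLp) ⬝ᵥ (‖z‖⁻¹ • z).ofLp = ‖z‖⁻¹ * inner ℝ v (x i) := by
      intro i
      rw [WithLp.ofLp_smul, dotProduct_smul, hzx, smul_eq_mul]
    simp only [← hS, e, mul_pow, ← Finset.mul_sum] at hu
    have hc : 0 < (‖z‖⁻¹) ^ 4 := by positivity
    refine le_of_mul_le_mul_left ?_ hc
    calc _ = (n : ℝ)⁻¹ * (‖z‖⁻¹ ^ 4 * ∑ i, inner ℝ v (x i) ^ 4) := by ring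
      _ ≤ _ := hu
      _ = _ := by ring

/-- Hölder's inequality between the first, second and fourth moments: under a fourth moment
comparison the second moment is controlled by the first. -/
lemma mean_sq_le_of_mean_pow_four_le {n : ℕ} (hn : 0 < n) {L : ℝ} (hL : 0 ≤ L) (D : Fin n → ℝ)
    (h : (n : ℝ)⁻¹ * ∑ i, D i ^ 4 ≤ L * ((n : ℝ)⁻¹ * ∑ i, D i ^ 2) ^ 2) :
    (n : ℝ)⁻¹ * ∑ i, D i ^ 2 ≤ L * ((n : ℝ)⁻¹ * ∑ i, |D i|) ^ 2 := by
  have hn' : (0 : ℝ) < (n : ℝ)⁻¹ := by positivity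
  have c1 : (∑ i, D i ^ 2) ^ 2 ≤ (∑ i, |D i|) * ∑ i, |D i| ^ 3 :=
    Finset.sum_sq_le_sum_mul_sum_of_sq_le_mul _ (fun i _ => abs_nonneg _)
      (fun i _ => by positivity) fun i _ => by rw [← sq_abs (D i)]; exact le_of_eq (by ring)
  have c2 : (∑ i, |D i| ^ 3) ^ 2 ≤ (∑ i, D i ^ 2) * ∑ i, D i ^ 4 :=
    Finset.sum_sq_le_sum_mul_sum_of_sq_le_mul _ (fun i _ => sq_nonneg _)
      (fun i _ => by positivity) fun i _ => by
        rw [← sq_abs (D i), show D i ^ 4 = |D i| ^ 4 by rw [(by decide : Even 4).pow_abs]]; exact le_of_eq (by ring)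
  set p1 := (n : ℝ)⁻¹ * ∑ i, |D i| with hp1
  set p2 := (n : ℝ)⁻¹ * ∑ i, D i ^ 2 with hp2
  set p3 := (n : ℝ)⁻¹ * ∑ i, |D i| ^ 3 with hp3
  set p4 := (n : ℝ)⁻¹ * ∑ i, D i ^ 4 with hp4
  have h2 : 0 ≤ p2 := mul_nonneg hn'.le (Finset.sum_nonneg fun i _ => sq_nonneg _)
  have c1' : p2 ^ 2 ≤ p1 * p3 := by
    calc p2 ^ 2 = (n : ℝ)⁻¹ ^ 2 * (∑ i, D i ^ 2) ^ 2 := by rw [hp2]; ring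
      _ ≤ (n : ℝ)⁻¹ ^ 2 * ((∑ i, |D i|) * ∑ i, |D i| ^ 3) := by gcongr
      _ = _ := by rw [hp1, hp3]; ring
  have c2' : p3 ^ 2 ≤ p2 * p4 := by
    calc p3 ^ 2 = (n : ℝ)⁻¹ ^ 2 * (∑ i, |D i| ^ 3) ^ 2 := by rw [hp3]; ring
      _ ≤ (n : ℝ)⁻¹ ^ 2 * ((∑ i, D i ^ 2) * ∑ i, D i ^ 4) := by gcongr
      _ = _ := by rw [hp2, hp4]; ring
  rcases h2.eq_or_lt with h0 | hpos
  · rw [← h0]; positivity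
  · have h3 : 0 < p2 ^ 3 := by positivity
    refine le_of_mul_le_mul_left ?_ h3
    calc p2 ^ 3 * p2 = (p2 ^ 2) ^ 2 := by ring
      _ ≤ (p1 * p3) ^ 2 := by gcongr
      _ = p1 ^ 2 * p3 ^ 2 := by ring
      _ ≤ p1 ^ 2 * (p2 * (L * p2 ^ 2)) := by gcongr; exact c2'.trans (by gcongr)
      _ = _ := by ring

/-! ### The excess risk as a squared distance -/

lemma integrable_sq_poisson {b : ℝ} (hb : 0 < b) :
    Integrable (fun k : ℕ => (k : ℝ) ^ 2) (poissonMeasure b.toNNReal) := by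
  -- an exponential moment of the Poisson law dominates `k²`
  have hI := (poisson_affinity (a := Real.exp 2 * b) (by positivity) hb).1.const_mul
    (2 * Real.exp ((Real.exp 2 * b - b) / 2))
  refine hI.mono' .of_discrete (Filter.Eventually.of_forall fun k => ?_)
  rw [mul_div_cancel_right₀ _ hb.ne', Real.log_exp, mul_assoc, ← Real.exp_add,
    show (Real.exp 2 * b - b) / 2 + ((k : ℝ) * 2 - (Real.exp 2 * b - b)) / 2 = k by ring,
    Real.norm_eq_abs, abs_of_nonneg (sq_nonneg _)]
  have := Real.quadratic_le_exp_of_nonneg (Nat.cast_nonneg (α := ℝ) k)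
  nlinarith [Nat.cast_nonneg (α := ℝ) k]

lemma integrable_natCast_poisson {b : ℝ} (hb : 0 < b) :
    Integrable (fun k : ℕ => (k : ℝ)) (poissonMeasure b.toNNReal) := by
  refine (integrable_sq_poisson hb).mono' .of_discrete (Filter.Eventually.of_forall fun k => ?_)
  rw [Real.norm_eq_abs, Nat.abs_cast]
  exact_mod_cast Nat.le_self_pow two_ne_zero k

lemma integral_natCast_poisson {b : ℝ} (hb : 0 < b) :
    ∫ k : ℕ, (k : ℝ) ∂(poissonMeasure b.toNNReal) = b := by
  refine (hasSum_integral_poissonMeasure (integrable_natCast_poisson hb)).unique ?_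
  rw [← hasSum_nat_add_iff' 1]
  have h := (hasSum_one_poissonMeasure b.toNNReal).mul_left b
  simp only [Real.coe_toNNReal b hb.le, mul_one, smul_eq_mul] at h ⊢
  simp only [Finset.range_one, Finset.sum_singleton, Nat.cast_zero, mul_zero, sub_zero]
  have e : ∀ k : ℕ, Real.exp (-b) * b ^ (k + 1) / ((k + 1).factorial : ℝ) * ((k + 1 : ℕ) : ℝ) =
      b * (Real.exp (-b) * b ^ k / (k.factorial : ℝ)) := by
    intro k
    rw [Nat.factorial_succ, Nat.cast_mul]
    have : ((k + 1 : ℕ) : ℝ) ≠ 0 := by positivity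
    field_simp
    ring
  simp_rw [e]
  exact h

lemma excessRisk_eq {n d : ℕ} (x : Fin n → EuclideanSpace ℝ (Fin d))
    (θs θ : EuclideanSpace ℝ (Fin d)) (hpos : ∀ i, 0 < inner ℝ θs (x i)) :
    excessRisk x θs θ = (n : ℝ)⁻¹ * ∑ i, (inner ℝ θ (x i) - inner ℝ θs (x i)) ^ 2 := by
  have hI1 : ∀ i, Integrable (fun y : Fin n → ℕ => (y i : ℝ)) (responseLaw x θs) := fun i =>
    integrable_comp_eval (μ := fun i => poissonMeasure (inner ℝ θs (x i)).toNNReal)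
      (integrable_natCast_poisson (hpos i))
  have hI2 : ∀ i, Integrable (fun y : Fin n → ℕ => (y i : ℝ) ^ 2) (responseLaw x θs) := fun i =>
    integrable_comp_eval (μ := fun i => poissonMeasure (inner ℝ θs (x i)).toNNReal)
      (f := fun k : ℕ => (k : ℝ) ^ 2) (integrable_sq_poisson (hpos i))
  have hE : ∀ i, ∫ y : Fin n → ℕ, (y i : ℝ) ∂(responseLaw x θs) = inner ℝ θs (x i) := fun i =>
    (integral_comp_eval (μ := fun i => poissonMeasure (inner ℝ θs (x i)).toNNReal)
      (f := fun k : ℕ => (k : ℝ)) .of_discrete).trans (integral_natCast_poisson (hpos i))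
  have : IsProbabilityMeasure (responseLaw x θs) := by unfold responseLaw; infer_instance
  have hI3 : ∀ i (c : ℝ), Integrable (fun y : Fin n → ℕ => ((y i : ℝ) - c) ^ 2)
      (responseLaw x θs) := by
    intro i c
    refine (((hI2 i).sub ((hI1 i).const_mul (2 * c))).add (integrable_const (c ^ 2))).congr
      (Filter.Eventually.of_forall fun y => ?_)
    simp only [Pi.add_apply, Pi.sub_apply]; ring
  have hS : ∀ θ', squareRisk x θs θ' = (n : ℝ)⁻¹ * ∑ i,
      ∫ y : Fin n → ℕ, ((y i : ℝ) - inner ℝ θ' (x i)) ^ 2 ∂(responseLaw x θs) := by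
    intro θ'
    rw [squareRisk, integral_const_mul, integral_finsetSum _ fun i _ => hI3 i _]
  rw [excessRisk, hS, hS, ← mul_sub, ← Finset.sum_sub_distrib]
  congr 1
  refine Finset.sum_congr rfl fun i _ => ?_
  rw [← integral_sub (hI3 i _) (hI3 i _)]
  set a := (inner ℝ θ (x i) : ℝ)
  set b := (inner ℝ θs (x i) : ℝ) with hb
  have e : ∀ y : Fin n → ℕ, ((y i : ℝ) - a) ^ 2 - ((y i : ℝ) - b) ^ 2 =
      2 * (b - a) * (y i : ℝ) + (a ^ 2 - b ^ 2) := fun y => by ring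
  simp_rw [e]
  rw [integral_add ((hI1 i).const_mul _) (integrable_const _), integral_const_mul, hE,
    integral_const, probReal_univ, one_smul, ← hb]
  ring

/-! ### The likelihood -/

lemma negLogLik_sub {n d : ℕ} (x : Fin n → EuclideanSpace ℝ (Fin d)) (y : Fin n → ℕ)
    (θs θ : EuclideanSpace ℝ (Fin d)) (hs : ∀ i, 0 < inner ℝ θs (x i))
    (hθ : ∀ i, 0 < inner ℝ θ (x i)) :
    negLogLik x y θs - negLogLik x y θ = ∑ i, (y i * Real.log (inner ℝ θ (x i) / inner ℝ θs (x i)) -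
      (inner ℝ θ (x i) - inner ℝ θs (x i))) := by
  have h : ∀ (k : ℕ) (t : ℝ), 0 < t → Real.log (t ^ k * Real.exp (-t) / (k.factorial : ℝ)) =
      k * Real.log t - t - Real.log (k.factorial : ℝ) := by
    intro k t ht
    rw [Real.log_div (by positivity) (by positivity), Real.log_mul (by positivity) (by positivity),
      Real.log_exp, Real.log_pow]
    ring
  rw [negLogLik, negLogLik, ← Finset.sum_sub_distrib]
  refine Finset.sum_congr rfl fun i _ => ?_
  rw [h _ _ (hs i), h _ _ (hθ i), Real.log_div (hθ i).ne' (hs i).ne']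
  ring

lemma inner_pos_of_mem_paramSpace {n d : ℕ} {x : Fin n → EuclideanSpace ℝ (Fin d)} {w γ : ℝ}
    (hγ : 0 < γ) {θ : EuclideanSpace ℝ (Fin d)} (h : θ ∈ paramSpace x w γ) (i : Fin n) :
    0 < inner ℝ θ (x i) :=
  hγ.trans_le ((h.2 i).trans (min_le_right _ _))

lemma exists_isMLE {n d : ℕ} {x : Fin n → EuclideanSpace ℝ (Fin d)} {w γ : ℝ} (hγ : 0 < γ)
    {θs : EuclideanSpace ℝ (Fin d)} (hs : θs ∈ paramSpace x w γ) (y : Fin n → ℕ) :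
    ∃ θ, IsMLE x w γ y θ := by
  have hc : IsCompact (paramSpace x w γ) := by
    refine Metric.isCompact_of_isClosed_isBounded ?_ ?_
    · have h : paramSpace x w γ =
          {θ | ‖θ‖ ≤ w} ∩ ⋂ i, {θ | γ ≤ min (‖θ‖ ^ 2) (inner ℝ θ (x i))} := by
        ext θ; simp [paramSpace]
      rw [h]
      exact (isClosed_le (by fun_prop) (by fun_prop)).inter
        (isClosed_iInter fun i => isClosed_le (by fun_prop) (by fun_prop))
    · exact Metric.isBounded_closedBall.subset fun θ h => mem_closedBall_zero_iff.2 h.1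
  have hcont : ContinuousOn (negLogLik x y) (paramSpace x w γ) := by
    refine continuousOn_finsetSum _ fun i _ => (ContinuousOn.log ?_ fun θ h => ?_).neg
    · fun_prop
    · have := inner_pos_of_mem_paramSpace hγ h i
      positivity
  exact hc.exists_isMinOn ⟨θs, hs⟩ hcont

/-- The likelihood ratio alone confines the total intensity: positive intensities `a` at least as
likely as `b` have a total bounded through the self-normalized deviation of `y`, whatever
the model `a` is taken from. -/
lemma sum_le_of_logLikRatio_nonneg {n : ℕ} (y : Fin n → ℕ) {a b : Fin n → ℝ} (ha : ∀ i, 0 < a i)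
    (hb : ∀ i, 0 < b i) (h : 0 ≤ ∑ i, (y i * Real.log (a i / b i) - (a i - b i))) :
    ∑ i, a i ≤ 2 * ∑ i, b i + 4 * ∑ i, (y i : ℝ) * Real.log (y i / b i) / 2 := by
  have key : ∀ i, (y i : ℝ) * Real.log (a i / b i) - (a i - b i) ≤
      b i - a i / 2 + y i * Real.log (y i / b i) := by
    intro i
    rcases Nat.eq_zero_or_pos (y i) with h0 | h0
    · rw [h0]; simp only [Nat.cast_zero, zero_mul]; linarith [ha i]
    · have hy : (0 : ℝ) < y i := by exact_mod_cast h0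
      have h1 := Real.log_le_sub_one_of_pos (show 0 < a i / (2 * y i) by have := ha i; positivity)
      have h2 : Real.log (a i / b i) =
          Real.log (a i / (2 * y i)) + Real.log (y i / b i) + Real.log 2 := by
        rw [Real.log_div (ha i).ne' (hb i).ne', Real.log_div (ha i).ne' (by positivity),
          Real.log_mul two_ne_zero hy.ne', Real.log_div hy.ne' (hb i).ne']
        ring
      have h3 := Real.log_two_lt_d9
      have h4 : (y i : ℝ) * Real.log (a i / (2 * y i)) ≤ a i / 2 - y i := by
        calc _ ≤ (y i : ℝ) * (a i / (2 * y i) - 1) := by gcongr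
          _ = _ := by field_simp
      rw [h2]
      nlinarith
  have h5 := h.trans (Finset.sum_le_sum fun i _ => key i)
  rw [Finset.sum_add_distrib, Finset.sum_sub_distrib, ← Finset.sum_div] at h5
  rw [← Finset.sum_div]
  linarith

/-- Rounding the intensities `a` up, to `|c i| + η`, costs at most `2 η` per observation in the
log-likelihood, uniformly in `y`. A Hellinger bound at the rounded intensities therefore transfers
to `a`. -/
lemma hellinger_le_of_near {n : ℕ} (y : Fin n → ℕ) {a b c : Fin n → ℝ} {η T : ℝ}
    (ha : ∀ i, 0 < a i) (hb : ∀ i, 0 < b i) (hc : ∀ i, |a i - c i| ≤ η)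
    (h : 0 ≤ ∑ i, (y i * Real.log (a i / b i) - (a i - b i)))
    (hT : ∑ i, (y i * Real.log ((|c i| + η) / b i) - (|c i| + η - b i)) / 2 ≤
      ∑ i, -(√(|c i| + η) - √(b i)) ^ 2 / 2 + T) :
    ∑ i, (√(a i) - √(b i)) ^ 2 ≤ 8 * (n * η) + 4 * T := by
  have hlo : ∀ i, a i ≤ |c i| + η := fun i => by
    have := abs_sub_abs_le_abs_sub (a i) (c i); have := le_abs_self (a i); linarith [hc i]
  have hup : ∀ i, |c i| + η ≤ a i + 2 * η := fun i => by
    have := abs_sub_abs_le_abs_sub (c i) (a i); rw [abs_sub_comm, abs_of_pos (ha i)] at this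
    linarith [hc i]
  have h1 : ∑ i, ((y i : ℝ) * Real.log (a i / b i) - (a i - b i)) ≤
      ∑ i, ((y i : ℝ) * Real.log ((|c i| + η) / b i) - (|c i| + η - b i) + 2 * η) := by
    refine Finset.sum_le_sum fun i _ => ?_
    have : (y i : ℝ) * Real.log (a i / b i) ≤ y i * Real.log ((|c i| + η) / b i) := by
      have := hb i
      have := hlo i
      have := ha i
      gcongr
    linarith [hup i]
  have h2 : ∑ i, (√(a i) - √(b i)) ^ 2 ≤
      ∑ i, (2 * (√(|c i| + η) - √(b i)) ^ 2 + 4 * η) := by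
    refine Finset.sum_le_sum fun i _ => ?_
    have hsq : √(a i) ≤ √(|c i| + η) := Real.sqrt_le_sqrt (hlo i)
    have e1 := Real.sq_sqrt (ha i).le
    have e2 := Real.sq_sqrt ((ha i).le.trans (hlo i))
    have h3 : (√(|c i| + η) - √(a i)) ^ 2 ≤ 2 * η := by
      nlinarith [mul_nonneg (Real.sqrt_nonneg (a i)) (sub_nonneg.2 hsq), hup i]
    nlinarith [sq_nonneg ((√(|c i| + η) - √(b i)) + (√(|c i| + η) - √(a i)))]
  simp only [Finset.sum_add_distrib, Finset.sum_const, Finset.card_univ, Fintype.card_fin,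
    nsmul_eq_mul, ← Finset.mul_sum] at h1 h2
  simp only [← Finset.sum_div, Finset.sum_neg_distrib] at hT
  linarith

lemma sum_abs_sub_sq_le_hellinger {n : ℕ} {a b : Fin n → ℝ} (ha : ∀ i, 0 < a i)
    (hb : ∀ i, 0 < b i) :
    (∑ i, |a i - b i|) ^ 2 ≤ (∑ i, (√(a i) - √(b i)) ^ 2) * (2 * (∑ i, a i + ∑ i, b i)) := by
  rw [← Finset.sum_add_distrib, Finset.mul_sum]
  refine Finset.sum_sq_le_sum_mul_sum_of_sq_le_mul _ (fun i _ => sq_nonneg _)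
    (fun i _ => by have := ha i; have := hb i; positivity) fun i _ => ?_
  have e1 := Real.sq_sqrt (ha i).le
  have e2 := Real.sq_sqrt (hb i).le
  have h : a i - b i = (√(a i) - √(b i)) * (√(a i) + √(b i)) := by linarith
  rw [sq_abs, h, mul_pow]
  gcongr
  nlinarith [sq_nonneg (√(a i) - √(b i))]

/-! ### The risk bound -/

/-- The vector of intensities `(⟨θ, xᵢ⟩)ᵢ` as a linear function of the parameter. -/
noncomputable def intensities {n d : ℕ} (x : Fin n → EuclideanSpace ℝ (Fin d)) :
    EuclideanSpace ℝ (Fin d) →ₗ[ℝ] EuclideanSpace ℝ (Fin n) where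
  toFun θ := WithLp.toLp 2 fun i => inner ℝ θ (x i)
  map_add' θ θ' := by ext i; simp [inner_add_left]
  map_smul' c θ := by ext i; simp [inner_smul_left]

lemma norm_le_sum_of_pos {n : ℕ} (v : EuclideanSpace ℝ (Fin n)) (h : ∀ i, 0 < v i) :
    ‖v‖ ≤ ∑ i, v i := by
  rw [EuclideanSpace.norm_eq, Real.sqrt_le_left (Finset.sum_nonneg fun i _ => (h i).le)]
  simp only [Real.norm_eq_abs, sq_abs]
  exact Finset.sum_sq_le_sq_sum_of_nonneg fun i _ => (h i).le

/-- The intensity vectors of total at most `c n m` are covered, in every coordinate and to accuracy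
`m / n`, by a number of points polynomial in `n`, to a power at most the dimension of the
parameter. Accuracy relative to the mean intensity `m` makes the count scale free. -/
lemma exists_intensity_net {n d : ℕ} (hn : 0 < n) (x : Fin n → EuclideanSpace ℝ (Fin d))
    {c m : ℝ} (hc : 0 < c) (hm : 0 < m) :
    ∃ N : Finset (EuclideanSpace ℝ (Fin n)),
      Real.log N.card ≤ d * (Real.log (2 * c + 3) + 3 * Real.log n) ∧
      ∀ θ, (∀ i, 0 < inner ℝ θ (x i)) → ∑ i, inner ℝ θ (x i) ≤ c * (n * m) →
        ∃ u ∈ N, ∀ i, |inner ℝ θ (x i) - u i| ≤ m / n := by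
  classical
  have hn' : (0 : ℝ) < n := by exact_mod_cast hn
  have hn1 : (1 : ℝ) ≤ n := by exact_mod_cast hn
  set W := LinearMap.range (intensities x)
  set k := Module.finrank ℝ W
  have hkd : k ≤ d := (LinearMap.finrank_range_le _).trans_eq finrank_euclideanSpace_fin
  have hkn : k ≤ n := (Submodule.finrank_le W).trans_eq finrank_euclideanSpace_fin
  set K := ⌈c * n ^ 3⌉₊
  obtain ⟨N, hcard, hN⟩ := exists_grid W (s := m / n ^ 2) (by positivity) K
  have hlog : 0 ≤ Real.log (2 * c + 3) + 3 * Real.log n :=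
    add_nonneg (Real.log_nonneg (by linarith)) (by have := Real.log_nonneg hn1; positivity)
  refine ⟨N.image Subtype.val, ?_, ?_⟩
  · rcases Nat.eq_zero_or_pos (N.image Subtype.val).card with h0 | h0
    · rw [h0, Nat.cast_zero, Real.log_zero]; positivity
    have h1 : ((N.image Subtype.val).card : ℝ) ≤ (2 * K + 1) ^ k := by
      exact_mod_cast Finset.card_image_le.trans hcard
    have h2 : (2 * K + 1 : ℝ) ≤ (2 * c + 3) * n ^ 3 := by
      have h3 : (K : ℝ) ≤ c * n ^ 3 + 1 := (Nat.ceil_lt_add_one (by positivity)).le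
      have h4 : (1 : ℝ) ≤ n ^ 3 := one_le_pow₀ hn1
      linarith
    calc Real.log (N.image Subtype.val).card ≤ Real.log (((2 * c + 3) * n ^ 3) ^ k) := by
          refine Real.log_le_log (by exact_mod_cast h0) (h1.trans ?_)
          gcongr
      _ = k * (Real.log (2 * c + 3) + 3 * Real.log n) := by
          rw [Real.log_pow, Real.log_mul (by positivity) (by positivity), Real.log_pow]
          norm_num
      _ ≤ _ := by gcongr
  · intro θ hpos hle
    have hnorm : ‖(⟨intensities x θ, θ, rfl⟩ : W)‖ ≤ m / n ^ 2 * K := by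
      refine (norm_le_sum_of_pos (intensities x θ) hpos).trans (hle.trans ?_)
      calc c * (n * m) = m / n ^ 2 * (c * n ^ 3) := by field_simp
        _ ≤ _ := by gcongr; exact Nat.le_ceil _
    obtain ⟨u, hu, hd⟩ := hN _ hnorm
    refine ⟨u, Finset.mem_image_of_mem _ hu, fun i => ?_⟩
    have h1 : |inner ℝ θ (x i) - (u : EuclideanSpace ℝ (Fin n)) i| ≤
        ‖intensities x θ - (u : EuclideanSpace ℝ (Fin n))‖ :=
      PiLp.norm_apply_le (intensities x θ - (u : EuclideanSpace ℝ (Fin n))) i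
    refine h1.trans (le_trans hd ?_)
    calc (k : ℝ) * (m / n ^ 2) ≤ n * (m / n ^ 2) := by gcongr
      _ = _ := by field_simp

/-- The event on which the maximum likelihood estimate is accurate: with probability `1 - δ`,
every positive intensity vector of the model at least as likely as the true one has a total
comparable with the true total, and is close to the true one in Hellinger distance. -/
lemma responseLaw_hellinger {n d : ℕ} (hn : 2 ≤ n) (x : Fin n → EuclideanSpace ℝ (Fin d))
    (θs : EuclideanSpace ℝ (Fin d)) {γ δ : ℝ} (hγ : 0 < γ) (hδ : 0 < δ)
    (hs : ∀ i, γ ≤ inner ℝ θs (x i)) (hlog : Real.log (1 / δ) ≤ ∑ i, inner ℝ θs (x i)) :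
    ENNReal.ofReal (1 - δ) ≤ responseLaw x θs {y | ∀ θ, (∀ i, 0 < inner ℝ θ (x i)) →
      negLogLik x y θ ≤ negLogLik x y θs →
      ∑ i, inner ℝ θ (x i) ≤ (30 + 8 / γ) * ∑ i, inner ℝ θs (x i) ∧
      ∑ i, (√(inner ℝ θ (x i)) - √(inner ℝ θs (x i))) ^ 2 ≤
        8 * ((n : ℝ)⁻¹ * ∑ i, inner ℝ θs (x i)) + 4 * (1 +
          d * (Real.log (2 * (30 + 8 / γ) + 3) + 3 * Real.log n) + Real.log (1 / δ))} := by
  have hn0 : 0 < n := by omega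
  have hn' : (0 : ℝ) < n := by exact_mod_cast hn0
  set b : Fin n → ℝ := fun i => inner ℝ θs (x i) with hb
  have hb0 : ∀ i, 0 < b i := fun i => hγ.trans_le (hs i)
  set S := ∑ i, b i with hS
  have hSγ : n * γ ≤ S := by
    calc n * γ = ∑ _i : Fin n, γ := by simp
      _ ≤ S := Finset.sum_le_sum fun i _ => hs i
  have hS0 : 0 < S := (by positivity : 0 < n * γ).trans_le hSγ
  set m := (n : ℝ)⁻¹ * S with hm
  have hm0 : 0 < m := by positivity
  have hnm : n * m = S := by rw [hm]; field_simp
  obtain ⟨N, hNcard, hN⟩ := exists_intensity_net hn0 x (c := 30 + 8 / γ) (by positivity) hm0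
  have hNpos : 0 < N.card := by
    obtain ⟨u, hu, -⟩ := hN θs hb0 (by
      rw [hnm]; exact le_mul_of_one_le_left hS0.le (by have : 0 < 8 / γ := by positivity
                                                       linarith))
    exact Finset.card_pos.2 ⟨u, hu⟩
  have hNpos' : (0 : ℝ) < N.card := by exact_mod_cast hNpos
  set p := δ / (2 * N.card) with hp
  have hp0 : 0 < p := by positivity
  have : IsProbabilityMeasure (responseLaw x θs) := by unfold responseLaw; infer_instance
  -- the self-normalized deviation is large
  let A : Set (Fin n → ℕ) := {y | ∑ i, (6 * b i + 1) + Real.log (1 / (δ / 2)) <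
    ∑ i, (y i : ℝ) * Real.log (y i / b i) / 2}
  have hA : responseLaw x θs A ≤ ENNReal.ofReal (δ / 2) :=
    pi_chernoff _ (fun i k => (k : ℝ) * Real.log (k / b i) / 2) (fun i => 6 * b i + 1)
      (fun i => (poisson_exp_half_mul_log (hb0 i)).1)
      (fun i => (poisson_exp_half_mul_log (hb0 i)).2) (by positivity)
  -- the likelihood ratio at a rounded net point beats its Hellinger bound
  let η := m / n
  have hη : 0 < η := by positivity
  let B : EuclideanSpace ℝ (Fin n) → Set (Fin n → ℕ) := fun u =>
    {y | ∑ i, -(√(|u i| + η) - √(b i)) ^ 2 / 2 + Real.log (1 / p) <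
      ∑ i, (y i * Real.log ((|u i| + η) / b i) - (|u i| + η - b i)) / 2}
  have hB : ∀ u, responseLaw x θs (B u) ≤ ENNReal.ofReal p := fun u =>
    pi_chernoff _ (fun i k => ((k : ℝ) * Real.log ((|u i| + η) / b i) - (|u i| + η - b i)) / 2)
      (fun i => -(√(|u i| + η) - √(b i)) ^ 2 / 2)
      (fun i => (poisson_affinity (by positivity) (hb0 i)).1)
      (fun i => (poisson_affinity (by positivity) (hb0 i)).2.le) hp0
  have hbad : responseLaw x θs (A ∪ ⋃ u ∈ N, B u) ≤ ENNReal.ofReal δ := by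
    calc _ ≤ responseLaw x θs A + responseLaw x θs (⋃ u ∈ N, B u) := measure_union_le _ _
      _ ≤ ENNReal.ofReal (δ / 2) + ∑ u ∈ N, responseLaw x θs (B u) := by
          gcongr; exact measure_biUnion_finset_le _ _
      _ ≤ ENNReal.ofReal (δ / 2) + ∑ _u ∈ N, ENNReal.ofReal p := by
          gcongr with u; exact hB u
      _ = ENNReal.ofReal (δ / 2) + ENNReal.ofReal (N.card * p) := by
          rw [Finset.sum_const, nsmul_eq_mul, ENNReal.ofReal_mul (by positivity),
            ENNReal.ofReal_natCast]
      _ = ENNReal.ofReal δ := by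
          rw [← ENNReal.ofReal_add (by positivity) (by positivity), hp]
          congr 1; field_simp; norm_num
  have hlog2 : Real.log 2 ≤ 1 := by linarith [Real.log_two_lt_d9]
  have hgood : ENNReal.ofReal (1 - δ) ≤ responseLaw x θs (A ∪ ⋃ u ∈ N, B u)ᶜ := by
    rw [ENNReal.ofReal_sub _ hδ.le, ENNReal.ofReal_one, tsub_le_iff_right]
    calc (1 : ENNReal) = responseLaw x θs Set.univ := measure_univ.symm
      _ ≤ responseLaw x θs (A ∪ ⋃ u ∈ N, B u)ᶜ + responseLaw x θs (A ∪ ⋃ u ∈ N, B u) := by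
          rw [← Set.compl_union_self (A ∪ ⋃ u ∈ N, B u)]; exact measure_union_le _ _
      _ ≤ _ := by gcongr
  refine hgood.trans (measure_mono fun y hy θ hθ hlik => ?_)
  rw [Set.mem_compl_iff, Set.mem_union, not_or, Set.mem_iUnion₂, not_exists] at hy
  obtain ⟨hyA, hyB⟩ := hy
  have hyA' : ∑ i, (y i : ℝ) * Real.log (y i / b i) / 2 ≤
      ∑ i, (6 * b i + 1) + Real.log (1 / (δ / 2)) := not_lt.1 hyA
  have hllr := sub_nonneg.2 hlik
  rw [negLogLik_sub x y θs θ hb0 hθ] at hllr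
  have hsum : ∑ i, inner ℝ θ (x i) ≤ (30 + 8 / γ) * S := by
    have h1 := sum_le_of_logLikRatio_nonneg y hθ hb0 hllr
    rw [Finset.sum_add_distrib, ← Finset.mul_sum, ← hS] at hyA'
    simp only [Finset.sum_const, Finset.card_univ, Fintype.card_fin, nsmul_eq_mul, mul_one] at hyA'
    have h2 : Real.log (1 / (δ / 2)) = Real.log 2 + Real.log (1 / δ) := by
      rw [← Real.log_mul two_ne_zero (by positivity)]; congr 1; field_simp
    have h3 : (n : ℝ) ≤ S / γ := by rwa [le_div_iff₀ hγ]
    have h4 : (1 : ℝ) ≤ n := by exact_mod_cast hn0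
    calc _ ≤ 2 * S + 4 * (6 * S + n + (Real.log 2 + Real.log (1 / δ))) := by
          rw [← h2]; linarith
      _ ≤ 2 * S + 4 * (7 * S + 2 * (S / γ)) := by linarith
      _ = _ := by ring
  refine ⟨hsum, ?_⟩
  obtain ⟨u, hu, hnear⟩ := hN θ hθ (by rwa [hnm])
  have hyu : y ∉ B u := fun h => hyB u ⟨hu, h⟩
  have h1 := hellinger_le_of_near y hθ hb0 hnear hllr (not_lt.1 hyu)
  have h2 : Real.log (1 / p) = Real.log 2 + Real.log N.card + Real.log (1 / δ) := by
    rw [← Real.log_mul two_ne_zero hNpos'.ne', ← Real.log_mul (by positivity) (by positivity), hp]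
    congr 1; field_simp
  have h3 : n * (m / n) = m := by field_simp
  rw [h2, h3] at h1
  refine h1.trans ?_
  gcongr

/-- The constant of the risk bound. -/
noncomputable def riskConst (L γ : ℝ) : ℝ :=
  2 * max L 1 * (31 + 8 / γ) * (16 + (24 + 8 * Real.log (2 * (30 + 8 / γ) + 3)) / γ)

lemma riskConst_pos (L : ℝ) {γ : ℝ} (hγ : 0 < γ) : 0 < riskConst L γ := by
  have h1 : 0 < 8 / γ := by positivity
  have h2 : 0 ≤ Real.log (2 * (30 + 8 / γ) + 3) := Real.log_nonneg (by linarith)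
  have h3 : 0 < max L 1 := lt_max_of_lt_right one_pos
  unfold riskConst; positivity

/-- Under hypercontractivity the mean square distance of two intensity vectors is bounded, up to
constants, by their mean squared Hellinger distance times the mean intensity: Hölder's inequality
passes to the mean absolute distance, and Cauchy-Schwarz to the Hellinger distance. -/
lemma excessRisk_le_of_hellinger {n d : ℕ} (hn : 0 < n) {L c H : ℝ}
    {x : Fin n → EuclideanSpace ℝ (Fin d)} {θs θ : EuclideanSpace ℝ (Fin d)}
    (hL : IsHypercontractive L x) (hcov : 0 < lamMin (designCov x))
    (hs : ∀ i, 0 < inner ℝ θs (x i)) (hθ : ∀ i, 0 < inner ℝ θ (x i))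
    (hsum : ∑ i, inner ℝ θ (x i) ≤ c * ∑ i, inner ℝ θs (x i))
    (hH : ∑ i, (√(inner ℝ θ (x i)) - √(inner ℝ θs (x i))) ^ 2 ≤ H) :
    excessRisk x θs θ ≤
      2 * max L 1 * (c + 1) * ((n : ℝ)⁻¹ * ∑ i, inner ℝ θs (x i)) * (H / n) := by
  have hn' : (0 : ℝ) < n := by exact_mod_cast hn
  have hL1 : 0 ≤ max L 1 := zero_le_one.trans (le_max_right _ _)
  have h4 : (n : ℝ)⁻¹ * ∑ i, (inner ℝ θ (x i) - inner ℝ θs (x i)) ^ 4 ≤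
      max L 1 * ((n : ℝ)⁻¹ * ∑ i, (inner ℝ θ (x i) - inner ℝ θs (x i)) ^ 2) ^ 2 := by
    have := hL.mean_inner_pow_four_le hcov (θ - θs)
    simp only [inner_sub_left] at this
    exact this.trans (mul_le_mul_of_nonneg_right (le_max_left _ _) (sq_nonneg _))
  have h2 := mean_sq_le_of_mean_pow_four_le hn hL1 _ h4
  have h1 := sum_abs_sub_sq_le_hellinger hθ hs
  rw [excessRisk_eq x θs θ hs]
  refine h2.trans ?_
  set S := ∑ i, (inner ℝ θs (x i) : ℝ)
  have hS : 0 ≤ S := Finset.sum_nonneg fun i _ => (hs i).le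
  have hH0 : 0 ≤ H := (Finset.sum_nonneg fun i _ => sq_nonneg _).trans hH
  calc _ = max L 1 * ((n : ℝ)⁻¹ ^ 2 * (∑ i, |inner ℝ θ (x i) - inner ℝ θs (x i)|) ^ 2) := by
        rw [mul_pow]
    _ ≤ max L 1 * ((n : ℝ)⁻¹ ^ 2 * (H * (2 * (c * S + S)))) := by
        gcongr
        refine h1.trans (mul_le_mul hH (by linarith) ?_ hH0)
        exact mul_nonneg zero_le_two (add_nonneg (Finset.sum_nonneg fun i _ => (hθ i).le) hS)
    _ = _ := by rw [div_eq_mul_inv]; ring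

end PoissonMLE

theorem corollary1 (L γ : ℝ) (hγ : 0 < γ) :
    ∃ C : ℝ, 0 < C ∧
      ∀ (n d : ℕ) (x : Fin n → EuclideanSpace ℝ (Fin d)) (θs : EuclideanSpace ℝ (Fin d))
        (w R δ : ℝ),
        2 ≤ n →
        0 < δ → δ < 1 →
        θs ∈ PoissonMLE.paramSpace x w γ →
        0 < PoissonMLE.lamMin (PoissonMLE.designCov x) →
        (∀ i, ‖x i‖ ≤ R) →
        R ^ 2 / (4 * n * γ ^ 2) *
            (d * Real.log (24 * PoissonMLE.condNumber (PoissonMLE.meanCov x θs)) +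
              Real.log (1 / δ)) ≤
          PoissonMLE.lamMin (PoissonMLE.meanCov x θs) →
        √(PoissonMLE.lamMax (PoissonMLE.meanCov x θs) *
            (d * Real.log (24 * PoissonMLE.condNumber (PoissonMLE.meanCov x θs)) +
              Real.log (1 / δ))) ≤
          √(n : ℝ) * PoissonMLE.lamMin (PoissonMLE.meanCov x θs) / 16 →
        PoissonMLE.IsHypercontractive L x →
        (∀ y, ∃ θ, PoissonMLE.IsMLE x w γ y θ) ∧
        ENNReal.ofReal (1 - δ) ≤
          PoissonMLE.responseLaw x θs
            {y | ∀ θ, PoissonMLE.IsMLE x w γ y θ →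
              PoissonMLE.excessRisk x θs θ ≤
                C * (‖θs‖ ^ 2 * PoissonMLE.lamMax (PoissonMLE.designCov x) *
                  (d * (Real.log n +
                      max 0 (Real.log (w * R * PoissonMLE.lamMax (PoissonMLE.designCov x))) +
                      Real.log (PoissonMLE.condNumber (PoissonMLE.meanCov x θs)) +
                      Real.log (1 / δ)) / n))} := by
  refine ⟨PoissonMLE.riskConst L γ, PoissonMLE.riskConst_pos L hγ, ?_⟩
  intro n d x θs w R δ hn hδ hδ1 hθs hcov hR hM1 hM2 hL
  have hn0 : 0 < n := by omega
  have hn' : (0 : ℝ) < n := by exact_mod_cast hn0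
  have hspos := PoissonMLE.inner_pos_of_mem_paramSpace hγ hθs
  have hsγ : ∀ i, γ ≤ inner ℝ θs (x i) := fun i => (hθs.2 i).trans (min_le_right _ _)
  have hd : 0 < d := by
    rcases Nat.eq_zero_or_pos d with rfl | h
    · rw [PoissonMLE.lamMin_eq_zero_of_dim_zero] at hcov; exact absurd hcov (lt_irrefl _)
    · exact h
  have hR0 : 0 < R := by
    refine (norm_pos_iff.2 fun h0 => ?_).trans_le (hR ⟨0, hn0⟩)
    have := hspos ⟨0, hn0⟩
    rw [h0, inner_zero_right] at this
    exact this.false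
  obtain ⟨hχ, hlog⟩ := PoissonMLE.one_le_condNumber_and_log_inv_le hn0 hd hγ hR0 hδ hδ1 x θs hspos
    hM1 hM2
  refine ⟨PoissonMLE.exists_isMLE hγ hθs, ?_⟩
  refine (PoissonMLE.responseLaw_hellinger hn x θs hγ hδ hsγ hlog).trans
    (measure_mono fun y hy θ hθ => ?_)
  have hθpos := PoissonMLE.inner_pos_of_mem_paramSpace hγ hθ.1
  obtain ⟨hsum, hH⟩ := hy θ hθpos (hθ.2 hθs)
  have hγ8 : 0 < 8 / γ := by positivity
  have hrisk := PoissonMLE.excessRisk_le_of_hellinger hn0 hL hcov hspos hθpos hsum hH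
  refine hrisk.trans ?_
  set m := (n : ℝ)⁻¹ * ∑ i, inner ℝ θs (x i) with hm
  set c := Real.log (2 * (30 + 8 / γ) + 3) with hc
  set ℓ := Real.log n with hℓ
  set t := Real.log (1 / δ) with ht
  have hmγ : γ ≤ m := by
    have : n * γ ≤ ∑ i, inner ℝ θs (x i) := by
      calc n * γ = ∑ _i : Fin n, γ := by simp
        _ ≤ _ := Finset.sum_le_sum fun i _ => hsγ i
    rw [hm, inv_mul_eq_div, le_div_iff₀ hn']; linarith
  have hm0 : 0 < m := hγ.trans_le hmγ
  have hm2 : m ^ 2 ≤ ‖θs‖ ^ 2 * PoissonMLE.lamMax (PoissonMLE.designCov x) := by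
    refine le_trans ?_ (PoissonMLE.mean_inner_sq_le x θs)
    have h1 := sq_sum_le_card_mul_sum_sq (s := Finset.univ) (f := fun i => inner ℝ θs (x i))
    rw [Finset.card_univ, Fintype.card_fin] at h1
    calc m ^ 2 = (n : ℝ)⁻¹ ^ 2 * (∑ i, inner ℝ θs (x i)) ^ 2 := by rw [hm, mul_pow]
      _ ≤ (n : ℝ)⁻¹ ^ 2 * (n * ∑ i, inner ℝ θs (x i) ^ 2) := by gcongr
      _ = _ := by field_simp
  have hc0 : 0 ≤ c := Real.log_nonneg (by linarith)
  have ht0 : 0 ≤ t := Real.log_nonneg (by rw [le_div_iff₀ hδ]; linarith)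
  have hℓ2 : 1 ≤ 2 * ℓ := by
    have h1 : Real.log 2 ≤ ℓ := Real.log_le_log two_pos (by exact_mod_cast hn)
    linarith [Real.log_two_gt_d9]
  have hd1 : (1 : ℝ) ≤ d := by exact_mod_cast hd
  -- the factor `d (log n + log (1 / δ))` absorbs every lower order term
  set Λ := d * (ℓ + t) with hΛ
  have hdℓ : d * ℓ ≤ Λ := by rw [hΛ]; gcongr; linarith
  have hdΛ : d ≤ 2 * Λ := by nlinarith
  have htΛ : t ≤ Λ := by rw [hΛ]; nlinarith
  have hΛ0 : 0 ≤ Λ := by linarith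
  have hHΛ : 8 * m + 4 * (1 + d * (c + 3 * ℓ) + t) ≤ m * (16 + (24 + 8 * c) / γ) * Λ := by
    calc 8 * m + 4 * (1 + d * (c + 3 * ℓ) + t)
        = 8 * m * 1 + 4 * 1 + 4 * c * d + 12 * (d * ℓ) + 4 * t := by ring
      _ ≤ 8 * m * (2 * Λ) + 4 * (2 * Λ) + 4 * c * (2 * Λ) + 12 * Λ + 4 * Λ := by
          gcongr <;> linarith
      _ = 16 * m * Λ + γ * ((24 + 8 * c) / γ) * Λ := by field_simp; ring
      _ ≤ 16 * m * Λ + m * ((24 + 8 * c) / γ) * Λ := by gcongr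
      _ = _ := by ring
  have hL1 : 0 < max L 1 := lt_max_of_lt_right one_pos
  have hχ0 : 0 ≤ Real.log (PoissonMLE.condNumber (PoissonMLE.meanCov x θs)) := Real.log_nonneg hχ
  have hC := (PoissonMLE.riskConst_pos L hγ).le
  calc _ ≤ 2 * max L 1 * (30 + 8 / γ + 1) * m * (m * (16 + (24 + 8 * c) / γ) * Λ / n) := by gcongr
    _ = PoissonMLE.riskConst L γ * (m ^ 2 * (Λ / n)) := by
        rw [PoissonMLE.riskConst, ← hc]; ring
    _ ≤ _ := by
        have h0 : 0 ≤ max 0 (Real.log (w * R * PoissonMLE.lamMax (PoissonMLE.designCov x))) :=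
          le_max_left _ _
        have hB0 := (sq_nonneg m).trans hm2
        rw [hΛ]
        refine mul_le_mul_of_nonneg_left (mul_le_mul hm2 ?_ (by positivity) hB0) hC
        gcongr
        linarith
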